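/- **Definitions.** A *skew lattice* (with zero) is an algebra $(S,\wedge,\vee,0)$ in which $\wedge,\vee$ are associative and idempotent, $x\wedge(x\vee y)=x=x\vee(x\wedge y)$, $(y\vee x)\wedge x=x=(y\wedge x)\vee x$, and $x\wedge 0=0=0\wedge x$. It is *left-handed* if $x\wedge y\wedge x=x\wedge y$, and *strongly distributive* if $x\wedge(y\vee z)=(x\wedge y)\vee(x\wedge z)$ and $(y\vee z)\wedge x=(y\wedge x)\vee(z\wedge x)$. Write $x\mathrel{\mathcal D}y$ if $x\wedge y\wedge x=x$ and $y\wedge x\wedge y=y$; $S/\mathcal D$ is the lattice reflection of $S$, and a homomorphism $h:S\to T$ (preserving $\wedge,\vee,0$) induces a lattice homomorphism $\bar h:S/\mathcal D\to T/\mathcal D$. Call $h$ *proper* if for every $y\in T/\mathcal D$ there is $x\in S/\mathcal D$ with $y\le\bar h(x)$. Let $\mathsf{DSL}$ be the category of left-handed strongly distributive skew lattices with zero and proper homomorphisms. The *ordered one-point compactification* $\hat X=X\cup\{*\}$ of a partially ordered topological space $X$ is its one-point compactification, with $*$ added as a maximum. $X$ is a *local Priestley space* if $\hat X$ is a Priestley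 space (compact and totally order-disconnected). A morphism $X\to Y$ in $\mathsf{LPS}$ is the restriction $f:X\to Y$ of a continuous monotone map $g:\hat X\to\hat Y$ with $g^{-1}(*)=\{*\}$. Let $\mathcal L(X)$ be the lattice of compact open downsets of $X$, and let $\mathcal L(f):\mathcal L(Y)\to\mathcal L(X)$ be $U\mapsto f^{-1}(U)$. An object $(X,E)$ of $\mathsf{Sh}(\mathsf{LPS})$ is a local Priestley space $X$ with a sheaf of sets $E$ on $X$ such that $E(U)\neq\emptyset$ for all open $U$. A morphism $(X,E)\to(Y,F)$ is a pair $(f,\lambda)$ with $f:X\to Y$ in $\mathsf{LPS}$ and $\lambda:F\Rightarrow f_*E$ a natural transformation, where $(f_*E)(V)=E(f^{-1}(V))$. Composition is $(g,\mu)\circ(f,\lambda)=(gf,\sigma)$ with $\sigma_U=\lambda_{g^{-1}(U)}\circ\mu_U$. The *dual algebra* of $(X,E)$ is $E^\star=\bigsqcup_{U\in\mathcal L(X)}E(U)$, where for $a\in E(U)$, $b\in E(V)$ the section $a\wedge b\in E(U\cap V)$ is $a|_{U\cap V}$, the section $a\vee b\in E(U\cup V)$ is the patch of $a|_{U\setminus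 V}$ and $b$, and $0$ is the unique element of $E(\emptyset)$. It is an object of $\mathsf{DSL}$, and $E^\star/\mathcal D\cong\mathcal L(X)$ by sending the class of a section to its domain. For $(f,\lambda):(X,E)\to(Y,F)$ the $\mathsf{DSL}$-morphism $(f,\lambda)^\star:F^\star\to E^\star$ is $a\mapsto\lambda_U(a)\in E(f^{-1}(U))$ for $a\in F(U)$, $U\in\mathcal L(Y)$. This defines a contravariant functor $(-)^\star:\mathsf{Sh}(\mathsf{LPS})\to\mathsf{DSL}$. **Proposition.** The contravariant functor $(-)^\star:\mathsf{Sh}(\mathsf{LPS})\to\mathsf{DSL}$ is full and faithful. That is, for all objects $(X,E)$ and $(Y,F)$ of $\mathsf{Sh}(\mathsf{LPS})$, the map $(f,\lambda)\mapsto(f,\lambda)^\star$ is a bijection from the morphisms $(X,E)\to(Y,F)$ in $\mathsf{Sh}(\mathsf{LPS})$ to the morphisms $F^\star\to E^\star$ in $\mathsf{DSL}$. Moreover: 1. If $h:F^\star\to E^\star$ is a morphism in $\mathsf{DSL}$ and $(f,\lambda)$ is the unique morphism with $(f,\lambda)^\star=h$, then $f$ is the unique morphism $X\to Y$ in $\mathsf{LPS}$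 such that $\bar h=\mathcal L(f)$ (under $F^\star/\mathcal D\cong\mathcal L(Y)$ and $E^\star/\mathcal D\cong\mathcal L(X)$), and $\lambda_U(s)=h(s)$ for all $U\in\mathcal L(Y)$ and $s\in F(U)$. 2. For a fixed morphism $f:X\to Y$ in $\mathsf{LPS}$, two natural transformations $\lambda,\lambda':F\Rightarrow f_*E$ are equal as soon as $\lambda_U=\lambda'_U$ for all $U\in\mathcal L(Y)$. They are also equal as soon as $\lambda_U=\lambda'_U$ for all $U$ in some basis of the topology of $Y$. -/

import Mathlib

open CategoryTheory TopologicalSpace Opposite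
open scoped OnePoint

universe u

namespace SkewDuality

/-! ### Skew lattices with zero -/

/-- A skew lattice with zero. -/
class SkewLattice (S : Type u) extends Min S, Max S, Zero S where
  inf_assoc' : ∀ x y z : S, (x ⊓ y) ⊓ z = x ⊓ (y ⊓ z)
  sup_assoc' : ∀ x y z : S, (x ⊔ y) ⊔ z = x ⊔ (y ⊔ z)
  inf_idem' : ∀ x : S, x ⊓ x = x
  sup_idem' : ∀ x : S, x ⊔ x = x
  inf_sup_absorb : ∀ x y : S, x ⊓ (x ⊔ y) = x
  sup_inf_absorb : ∀ x y : S, x ⊔ (x ⊓ y) = x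
  absorb_sup_inf : ∀ x y : S, (y ⊔ x) ⊓ x = x
  absorb_inf_sup : ∀ x y : S, (y ⊓ x) ⊔ x = x
  inf_zero' : ∀ x : S, x ⊓ 0 = 0
  zero_inf' : ∀ x : S, 0 ⊓ x = 0

class IsLeftHanded (S : Type u) [SkewLattice S] : Prop where
  left_handed : ∀ x y : S, x ⊓ y ⊓ x = x ⊓ y

class IsStronglyDistributive (S : Type u) [SkewLattice S] : Prop where
  inf_sup_distrib_left : ∀ x y z : S, x ⊓ (y ⊔ z) = (x ⊓ y) ⊔ (x ⊓ z)
  inf_sup_distrib_right : ∀ x y z : S, (y ⊔ z) ⊓ x = (y ⊓ x) ⊔ (z ⊓ x)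

/-- The relation `𝒟` on a skew lattice. -/
def DRel {S : Type u} [SkewLattice S] (x y : S) : Prop :=
  x ⊓ y ⊓ x = x ∧ y ⊓ x ⊓ y = y

section Reflection

variable {S : Type u} [SkewLattice S]

open SkewLattice

theorem dRel_iff_inf [IsLeftHanded S] {x y : S} : DRel x y ↔ x ⊓ y = x ∧ y ⊓ x = y := by
  simp only [DRel, IsLeftHanded.left_handed]

theorem sup_left_handed [IsLeftHanded S] (x y : S) : x ⊔ (y ⊔ x) = y ⊔ x := by
  have h : x ⊓ (y ⊔ x) = x := by
    rw [← IsLeftHanded.left_handed, inf_assoc', absorb_sup_inf, inf_idem']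
  conv_lhs => rw [← h]
  rw [h]
  have := absorb_inf_sup (y ⊔ x) x
  rwa [h] at this

theorem dRel_iff_sup [IsLeftHanded S] {x y : S} : DRel x y ↔ x ⊔ y = y ∧ y ⊔ x = x := by
  rw [dRel_iff_inf]
  constructor
  · rintro ⟨h, k⟩
    constructor
    · have := absorb_inf_sup y x; rwa [h] at this
    · have := absorb_inf_sup x y; rwa [k] at this
  · rintro ⟨h, k⟩
    constructor
    · have := inf_sup_absorb x y; rwa [h] at this
    · have := inf_sup_absorb y x; rwa [k] at this

theorem dRel_refl (x : S) : DRel x x := by simp [DRel, inf_idem']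

theorem dRel_symm {x y : S} (h : DRel x y) : DRel y x := ⟨h.2, h.1⟩

variable [IsLeftHanded S]

theorem dRel_trans {x y z : S} (h : DRel x y) (k : DRel y z) : DRel x z := by
  rw [dRel_iff_inf] at *
  constructor
  · rw [← h.1, inf_assoc', k.1]
  · rw [← k.2, inf_assoc', h.2]

theorem dRel_inf {x x' y y' : S} (h : DRel x x') (k : DRel y y') : DRel (x ⊓ y) (x' ⊓ y') := by
  rw [dRel_iff_inf] at *
  have key : ∀ {x x' y y' : S}, x ⊓ x' = x → y ⊓ y' = y → (x ⊓ y) ⊓ (x' ⊓ y') = x ⊓ y := by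
    intro x x' y y' h k
    have e : x ⊓ y ⊓ x' = x ⊓ y := by
      conv_lhs => rw [← h]
      rw [inf_assoc', inf_assoc', ← inf_assoc' x' y x', IsLeftHanded.left_handed, ← inf_assoc', h]
    rw [← inf_assoc', e, inf_assoc', k]
  exact ⟨key h.1 k.1, key h.2 k.2⟩

theorem dRel_sup {x x' y y' : S} (h : DRel x x') (k : DRel y y') : DRel (x ⊔ y) (x' ⊔ y') := by
  rw [dRel_iff_sup] at *
  have key : ∀ {x x' y y' : S}, x ⊔ x' = x' → y ⊔ y' = y' → (x ⊔ y) ⊔ (x' ⊔ y') = x' ⊔ y' := by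
    intro x x' y y' h k
    have e : y ⊔ (x' ⊔ y') = x' ⊔ y' := by
      conv_lhs => rw [← k]
      rw [← sup_assoc' x', ← sup_assoc', ← sup_assoc', sup_assoc' y x' y, sup_left_handed,
        sup_assoc', k]
    rw [sup_assoc', e, ← sup_assoc', h]
  exact ⟨key h.1 k.1, key h.2 k.2⟩

variable (S) in
/-- The setoid of `𝒟` on a left-handed skew lattice. -/
def dSetoid : Setoid S := ⟨DRel, dRel_refl, dRel_symm, dRel_trans⟩

variable (S) in
/-- The lattice reflection `S/𝒟`. -/
def LatticeReflection : Type u := Quotient (dSetoid S)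

/-- The quotient map `α : S → S/𝒟`. -/
def toReflection (x : S) : LatticeReflection S := Quotient.mk (dSetoid S) x

theorem toReflection_eq_iff {x y : S} : toReflection x = toReflection y ↔ DRel x y :=
  Quotient.eq (r := dSetoid S)

/-- `S/𝒟` is a lattice, with the operations induced by those of `S`; its order is
`p ≤ q ↔ p ⊓ q = p`, equivalently `p ⊔ q = q`. -/
instance : Lattice (LatticeReflection S) :=
  letI : Max (LatticeReflection S) :=
    ⟨Quotient.map₂ (· ⊔ ·) fun _ _ h _ _ k => dRel_sup h k⟩
  letI : Min (LatticeReflection S) :=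
    ⟨Quotient.map₂ (· ⊓ ·) fun _ _ h _ _ k => dRel_inf h k⟩
  Lattice.mk'
    (by
      rintro ⟨x⟩ ⟨y⟩
      refine Quotient.sound (s := dSetoid S) (dRel_iff_sup.2 ⟨?_, ?_⟩)
      · dsimp only
        rw [sup_assoc', ← sup_assoc' y, sup_idem', sup_left_handed]
      · dsimp only
        rw [sup_assoc', ← sup_assoc' x, sup_idem', sup_left_handed])
    (by rintro ⟨x⟩ ⟨y⟩ ⟨z⟩; exact congrArg toReflection (sup_assoc' x y z))
    (by
      rintro ⟨x⟩ ⟨y⟩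
      refine Quotient.sound (s := dSetoid S) (dRel_iff_inf.2 ⟨?_, ?_⟩)
      · dsimp only
        rw [inf_assoc', ← inf_assoc' y, inf_idem', ← inf_assoc', IsLeftHanded.left_handed]
      · dsimp only
        rw [inf_assoc', ← inf_assoc' x, inf_idem', ← inf_assoc', IsLeftHanded.left_handed])
    (by rintro ⟨x⟩ ⟨y⟩ ⟨z⟩; exact congrArg toReflection (inf_assoc' x y z))
    (by rintro ⟨x⟩ ⟨y⟩; exact congrArg toReflection (sup_inf_absorb x y))
    (by rintro ⟨x⟩ ⟨y⟩; exact congrArg toReflection (inf_sup_absorb x y))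

theorem toReflection_inf (x y : S) : toReflection (x ⊓ y) = toReflection x ⊓ toReflection y := rfl

theorem toReflection_sup (x y : S) : toReflection (x ⊔ y) = toReflection x ⊔ toReflection y := rfl

theorem toReflection_le_iff {x y : S} : toReflection x ≤ toReflection y ↔ x ⊓ y = x := by
  rw [← inf_eq_left, ← toReflection_inf, toReflection_eq_iff, dRel_iff_inf]
  constructor
  · intro h
    have := h.2
    rwa [← inf_assoc', inf_idem'] at this
  · intro h
    rw [h, inf_idem', and_self]

end Reflection

/-- Homomorphisms of skew lattices with zero. -/
@[ext]
structure SkewHom (S T : Type u) [SkewLattice S] [SkewLattice T] where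
  toFun : S → T
  map_inf' : ∀ x y, toFun (x ⊓ y) = toFun x ⊓ toFun y
  map_sup' : ∀ x y, toFun (x ⊔ y) = toFun x ⊔ toFun y
  map_zero' : toFun 0 = 0

/-- The lattice homomorphism `h̄ : S/𝒟 → T/𝒟` induced by `h : S → T`. -/
def SkewHom.bar {S T : Type u} [SkewLattice S] [IsLeftHanded S] [SkewLattice T] [IsLeftHanded T]
    (h : SkewHom S T) : LatticeHom (LatticeReflection S) (LatticeReflection T) where
  toFun := Quotient.map h.toFun fun x y (k : DRel x y) => by
    refine (⟨?_, ?_⟩ : DRel (h.toFun x) (h.toFun y))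
    · rw [← h.map_inf', ← h.map_inf', k.1]
    · rw [← h.map_inf', ← h.map_inf', k.2]
  map_sup' := by
    rintro ⟨x⟩ ⟨y⟩; exact congrArg toReflection (h.map_sup' x y)
  map_inf' := by
    rintro ⟨x⟩ ⟨y⟩; exact congrArg toReflection (h.map_inf' x y)

/-- A lattice homomorphism is proper if its image is cofinal. -/
def IsProperLatticeHom {L M : Type u} [Lattice L] [Lattice M] (k : LatticeHom L M) : Prop :=
  ∀ y : M, ∃ x : L, y ≤ k x

/-- Left-handed strongly distributive skew lattices with zero. -/
structure DSL : Type (u + 1) where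
  carrier : Type u
  [skew : SkewLattice carrier]
  [leftHanded : IsLeftHanded carrier]
  [stronglyDistributive : IsStronglyDistributive carrier]

attribute [instance] DSL.skew DSL.leftHanded DSL.stronglyDistributive

/-- Morphisms of `DSL` are the proper homomorphisms. -/
@[ext]
structure DSL.Hom (S T : DSL.{u}) extends SkewHom S.carrier T.carrier where
  proper : IsProperLatticeHom toSkewHom.bar

instance : Category DSL.{u} where
  Hom := DSL.Hom
  id S :=
    { toFun := fun x => x
      map_inf' := fun _ _ => rfl
      map_sup' := fun _ _ => rfl
      map_zero' := rfl
      proper := by rintro ⟨y⟩; exact ⟨toReflection y, le_rfl⟩ }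
  comp {S T U} g h :=
    { toFun := fun x => h.toFun (g.toFun x)
      map_inf' := fun x y => by rw [g.map_inf', h.map_inf']
      map_sup' := fun x y => by rw [g.map_sup', h.map_sup']
      map_zero' := by rw [g.map_zero', h.map_zero']
      proper := by
        intro z
        obtain ⟨y, hy⟩ := h.proper z
        obtain ⟨⟨x⟩, hx⟩ := g.proper y
        exact ⟨toReflection x, hy.trans (OrderHomClass.mono h.toSkewHom.bar hx)⟩ }

/-! ### Local Priestley spaces -/

/-- The ordered one-point compactification: `OnePoint X` is ordered by extending the order of `X`
with `∞` as a maximum. -/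
instance onePointOrder (X : Type u) [PartialOrder X] : PartialOrder (OnePoint X) where
  le p q := q = ∞ ∨ ∃ x y : X, p = x ∧ q = y ∧ x ≤ y
  le_refl p := by
    induction p using OnePoint.rec with
    | infty => exact Or.inl rfl
    | coe x => exact Or.inr ⟨x, x, rfl, rfl, le_rfl⟩
  le_trans p q r := by
    rintro (rfl | ⟨x, y, rfl, rfl, h⟩) (rfl | ⟨y', z, h1, rfl, k⟩)
    · exact Or.inl rfl
    · exact absurd h1 (OnePoint.infty_ne_coe _)
    · exact Or.inl rfl
    · obtain rfl := OnePoint.coe_injective h1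
      exact Or.inr ⟨x, z, rfl, rfl, h.trans k⟩
  le_antisymm p q := by
    rintro (rfl | ⟨x, y, rfl, rfl, h⟩) (h0 | ⟨y', z, h1, h2, k⟩)
    · exact h0
    · exact absurd h1 (OnePoint.infty_ne_coe _)
    · exact absurd h0 (OnePoint.coe_ne_infty _)
    · obtain rfl := OnePoint.coe_injective h1
      obtain rfl := OnePoint.coe_injective h2
      exact congrArg _ (le_antisymm h k)

theorem onePoint_le_infty {X : Type u} [PartialOrder X] (p : OnePoint X) : p ≤ ∞ := Or.inl rfl

theorem onePoint_coe_le_coe {X : Type u} [PartialOrder X] {x y : X} :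
    (x : OnePoint X) ≤ y ↔ x ≤ y := by
  constructor
  · rintro (h | ⟨x', y', h1, h2, k⟩)
    · exact absurd h (OnePoint.coe_ne_infty _)
    · rwa [OnePoint.coe_injective h1, OnePoint.coe_injective h2]
  · exact fun h => Or.inr ⟨x, y, rfl, rfl, h⟩

theorem onePoint_not_infty_le {X : Type u} [PartialOrder X] (x : X) :
    ¬ (∞ : OnePoint X) ≤ x := by
  rintro (h | ⟨x', y', h1, h2, k⟩)
  · exact OnePoint.coe_ne_infty _ h
  · exact OnePoint.infty_ne_coe _ h1

/-- `X` is a local Priestley space if its ordered one-point compactification is a Priestley space,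
i.e. compact and totally order-disconnected. -/
def IsLocalPriestley (X : Type u) [TopologicalSpace X] [PartialOrder X] : Prop :=
  CompactSpace (OnePoint X) ∧ PriestleySpace (OnePoint X)

structure LPS : Type (u + 1) where
  carrier : Type u
  [top : TopologicalSpace carrier]
  [order : PartialOrder carrier]
  isLocalPriestley : IsLocalPriestley carrier

attribute [instance] LPS.top LPS.order

instance : CoeSort LPS.{u} (Type u) := ⟨LPS.carrier⟩

/-- Morphisms of `LPS`: restrictions to `X` of continuous monotone maps `g` between the ordered
one-point compactifications with `g⁻¹(∞) = {∞}`. -/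
@[ext]
structure LPS.Hom (X Y : LPS.{u}) where
  toFun : X → Y
  extends_onePoint : ∃ g : OnePoint X → OnePoint Y, Continuous g ∧ Monotone g ∧
    g ⁻¹' {∞} = {∞} ∧ ∀ x : X, g x = toFun x

instance : Category LPS.{u} where
  Hom := LPS.Hom
  id X := ⟨fun x => x, id, continuous_id, monotone_id, rfl, fun _ => rfl⟩
  comp {X Y Z} f g := ⟨fun x => g.toFun (f.toFun x), by
    obtain ⟨f', hf1, hf2, hf3, hf4⟩ := f.extends_onePoint
    obtain ⟨g', hg1, hg2, hg3, hg4⟩ := g.extends_onePoint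
    refine ⟨g' ∘ f', hg1.comp hf1, hg2.comp hf2, ?_, fun x => ?_⟩
    · rw [Set.preimage_comp, hg3, hf3]
    · rw [Function.comp_apply, hf4, hg4]⟩

theorem LPS.Hom.continuous {X Y : LPS.{u}} (f : LPS.Hom X Y) : Continuous f.toFun := by
  obtain ⟨g, h1, -, -, h4⟩ := f.extends_onePoint
  rw [OnePoint.isOpenEmbedding_coe.isEmbedding.continuous_iff]
  have : ((↑) : Y → OnePoint Y) ∘ f.toFun = g ∘ (↑) := by
    ext x; exact (h4 x).symm
  rw [this]
  exact h1.comp OnePoint.continuous_coe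

theorem LPS.Hom.monotone {X Y : LPS.{u}} (f : LPS.Hom X Y) : Monotone f.toFun := by
  obtain ⟨g, -, h2, -, h4⟩ := f.extends_onePoint
  intro x y h
  rw [← onePoint_coe_le_coe, ← h4, ← h4]
  exact h2 (onePoint_coe_le_coe.2 h)

theorem LPS.t2 (X : LPS.{u}) : T2Space X := by
  have := X.isLocalPriestley.2
  exact OnePoint.isOpenEmbedding_coe.isEmbedding.t2Space

theorem LPS.Hom.isCompact_preimage {X Y : LPS.{u}} (f : LPS.Hom X Y) {K : Set Y}
    (hK : IsCompact K) : IsCompact (f.toFun ⁻¹' K) := by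
  have := Y.isLocalPriestley.2
  obtain ⟨g, h1, -, h3, h4⟩ := f.extends_onePoint
  have hc : IsClosed (((↑) : Y → OnePoint Y) '' K) := (hK.image OnePoint.continuous_coe).isClosed
  have hk := (hc.preimage h1).isCompact
  have e : g ⁻¹' (((↑) : Y → OnePoint Y) '' K) = ((↑) : X → OnePoint X) '' (f.toFun ⁻¹' K) := by
    ext p
    induction p using OnePoint.rec with
    | infty =>
      have : g ∞ = ∞ := by
        have : (∞ : OnePoint X) ∈ g ⁻¹' {∞} := by rw [h3]; rfl
        exact this
      simp [this]
    | coe x => simp [h4]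
  rw [e] at hk
  exact OnePoint.isOpenEmbedding_coe.isInducing.isCompact_iff.2 hk

/-- `ℒ(X)`: the compact open downsets of `X`, ordered by inclusion. -/
@[ext]
structure CompactOpenDownset (X : LPS.{u}) : Type u where
  toOpens : Opens X
  isCompact : IsCompact (toOpens : Set X)
  isLowerSet : IsLowerSet (toOpens : Set X)

namespace CompactOpenDownset

instance (X : LPS.{u}) : PartialOrder (CompactOpenDownset X) :=
  PartialOrder.lift toOpens fun _ _ h => CompactOpenDownset.ext h

variable {X : LPS.{u}}

/-- Intersection. -/
def inter (U V : CompactOpenDownset X) : CompactOpenDownset X where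
  toOpens := U.toOpens ⊓ V.toOpens
  isCompact := by
    have := X.t2
    exact U.isCompact.inter V.isCompact
  isLowerSet := U.isLowerSet.inter V.isLowerSet

/-- Union. -/
def union (U V : CompactOpenDownset X) : CompactOpenDownset X where
  toOpens := U.toOpens ⊔ V.toOpens
  isCompact := U.isCompact.union V.isCompact
  isLowerSet := U.isLowerSet.union V.isLowerSet

/-- The empty set. -/
def empty : CompactOpenDownset X := ⟨⊥, isCompact_empty, isLowerSet_empty⟩

/-- The open set `U \ V`. -/
def sdiff (U V : CompactOpenDownset X) : Opens X where
  carrier := (U.toOpens : Set X) \ V.toOpens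
  is_open' := by
    have := X.t2
    exact U.toOpens.isOpen.sdiff V.isCompact.isClosed

theorem mem_sdiff {U V : CompactOpenDownset X} {x : X} :
    x ∈ U.sdiff V ↔ x ∈ U.toOpens ∧ x ∉ V.toOpens := Iff.rfl

theorem mem_union {U V : CompactOpenDownset X} {x : X} :
    x ∈ (U.union V).toOpens ↔ x ∈ U.toOpens ∨ x ∈ V.toOpens := Iff.rfl

theorem mem_inter {U V : CompactOpenDownset X} {x : X} :
    x ∈ (U.inter V).toOpens ↔ x ∈ U.toOpens ∧ x ∈ V.toOpens := Iff.rfl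

/-- `ℒ(f)`: the map `U ↦ f⁻¹(U)` from `ℒ(Y)` to `ℒ(X)`. -/
def comap {X Y : LPS.{u}} (f : X ⟶ Y) (U : CompactOpenDownset Y) : CompactOpenDownset X where
  toOpens := ⟨f.toFun ⁻¹' U.toOpens, U.toOpens.isOpen.preimage f.continuous⟩
  isCompact := f.isCompact_preimage U.isCompact
  isLowerSet := fun _ _ h hx => U.isLowerSet (f.monotone h) hx

end CompactOpenDownset

/-- Every compact subset of a local Priestley space lies in a compact open downset. -/
theorem LPS.exists_downset (X : LPS.{u}) {K : Set X} (hK : IsCompact K) :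
    ∃ U : CompactOpenDownset X, K ⊆ (U.toOpens : Set X) := by
  have := X.isLocalPriestley.2
  refine hK.induction_on (p := fun s => ∃ U : CompactOpenDownset X, s ⊆ (U.toOpens : Set X)) ?_ ?_ ?_ ?_
  · exact ⟨.empty, Set.empty_subset _⟩
  · rintro s t hst ⟨U, hU⟩; exact ⟨U, hst.trans hU⟩
  · rintro s t ⟨U, hU⟩ ⟨V, hV⟩
    exact ⟨U.union V, Set.union_subset_union hU hV⟩
  · intro x _
    obtain ⟨W, hW1, hW2, hW3, hW4⟩ :=
      exists_isClopen_lower_of_not_le (onePoint_not_infty_le x)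
    refine ⟨((↑) : X → OnePoint X) ⁻¹' W,
      mem_nhdsWithin_of_mem_nhds ((hW1.isOpen.preimage OnePoint.continuous_coe).mem_nhds hW4),
      ⟨⟨((↑) : X → OnePoint X) ⁻¹' W, hW1.isOpen.preimage OnePoint.continuous_coe⟩, ?_, ?_⟩,
      subset_rfl⟩
    · exact ((OnePoint.isClosed_iff_of_notMem hW3).1 hW1.isClosed).2
    · exact fun a b h hb => hW2 (onePoint_coe_le_coe.2 h) hb

/-! ### Sheaves over local Priestley spaces -/

/-- The continuous map underlying a morphism of local Priestley spaces. -/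
def LPS.Hom.toTop {X Y : LPS.{u}} (f : X ⟶ Y) : TopCat.of X ⟶ TopCat.of Y :=
  TopCat.ofHom ⟨f.toFun, f.continuous⟩

/-- A sheaf of sets with global support over a local Priestley space. -/
structure ShLPS : Type (u + 1) where
  base : LPS.{u}
  presheaf : TopCat.Presheaf (Type u) (TopCat.of base)
  isSheaf : presheaf.IsSheaf
  globalSupport : ∀ U : Opens base, Nonempty (presheaf.obj (op U))

/-- The underlying object of Mathlib's category of sheaves. -/
def ShLPS.sheaf (E : ShLPS.{u}) : TopCat.Sheaf (Type u) (TopCat.of E.base) :=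
  ⟨E.presheaf, E.isSheaf⟩

/-- The direct image `f_* E`, with `(f_* E)(V) = E(f⁻¹(V))`. -/
abbrev directImage {X Y : LPS.{u}} (f : X ⟶ Y) (E : TopCat.Presheaf (Type u) (TopCat.of X)) :
    TopCat.Presheaf (Type u) (TopCat.of Y) :=
  (TopCat.Presheaf.pushforward (Type u) (LPS.Hom.toTop f)).obj E

/-- Morphisms `(f, λ)` with `f : X → Y` in `LPS` and `λ : F ⟶ f_* E`. -/
@[ext]
structure ShLPS.Hom (E F : ShLPS.{u}) where
  base : E.base ⟶ F.base
  nat : F.presheaf ⟶ directImage base E.presheaf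

/-- The composite of `(f, λ)` and `(g, μ)` is `(g ∘ f, σ)` with `σ_U = λ_{g⁻¹(U)} ∘ μ_U`. -/
instance : Category ShLPS.{u} where
  Hom := ShLPS.Hom
  id E := ⟨𝟙 E.base, 𝟙 E.presheaf⟩
  comp {E F G} φ ψ := ⟨φ.base ≫ ψ.base,
    ψ.nat ≫ (TopCat.Presheaf.pushforward (Type u) (LPS.Hom.toTop ψ.base)).map φ.nat⟩
  id_comp φ := by
    refine ShLPS.Hom.ext rfl (heq_of_eq ?_)
    ext U x
    rfl
  comp_id φ := by
    refine ShLPS.Hom.ext rfl (heq_of_eq ?_)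
    ext U x
    rfl
  assoc φ ψ χ := by
    refine ShLPS.Hom.ext rfl (heq_of_eq ?_)
    ext U x
    rfl

/-! ### The dual algebra -/

/-- The underlying set of `E^⋆`: local sections over compact open downsets. -/
structure DualAlgebra (E : ShLPS.{u}) : Type u where
  dom : CompactOpenDownset E.base
  sec : E.presheaf.obj (op dom.1)

namespace DualAlgebra

variable {E F : ShLPS.{u}}

/-- Restriction `s|_V` of a section. -/
def res {U V : Opens E.base} (h : V ≤ U) (s : E.presheaf.obj (op U)) : E.presheaf.obj (op V) :=
  E.presheaf.map (homOfLE h).op s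

/-- `s` is the override of `a` with `b`: it equals `b` on `dom b` and `a` on `dom a \ dom b`. -/
def IsOverride (a b : DualAlgebra E) (s : E.presheaf.obj (op (a.dom.union b.dom).toOpens)) : Prop :=
  res (V := b.dom.toOpens) le_sup_right s = b.sec ∧
    res (V := a.dom.sdiff b.dom) (fun _ h => Or.inl h.1) s =
      res (V := a.dom.sdiff b.dom) (fun _ h => h.1) a.sec

theorem existsUnique_override (a b : DualAlgebra E) : ∃! s, IsOverride a b s := by
  let U : Bool → Opens (TopCat.of E.base) := fun t => if t then b.dom.toOpens else a.dom.sdiff b.dom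
  have iUV : ∀ t, U t ≤ (a.dom.union b.dom).toOpens := by
    rintro (_ | _)
    · exact fun x h => Or.inl h.1
    · exact fun x h => Or.inr h
  let sf : ∀ t, ToType (E.presheaf.obj (op (U t))) := fun t =>
    match t with
    | true => b.sec
    | false => res (V := a.dom.sdiff b.dom) (fun _ h => h.1) a.sec
  have hcov : (a.dom.union b.dom).toOpens ≤ iSup U := by
    intro x hx
    rw [Opens.mem_iSup]
    by_cases hb : x ∈ b.dom.toOpens
    · exact ⟨true, hb⟩
    · exact ⟨false, hx.resolve_right hb, hb⟩
  have hcomp : TopCat.Presheaf.IsCompatible E.sheaf.1 U sf := by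
    have hempty : ∀ {W : Opens (TopCat.of E.base)} (_ : W ≤ ⊥)
        (s t : E.presheaf.obj (op W)), s = t := fun {W} hW s t =>
      E.sheaf.eq_of_locally_eq' (ι := PEmpty.{1}) (fun _ => ⊥) W (fun i => i.elim)
        (hW.trans bot_le) s t (fun i => i.elim)
    rintro (_ | _) (_ | _)
    · rfl
    · exact hempty (fun x hx => (CompactOpenDownset.mem_sdiff.1 (Opens.mem_inf.1 hx).1).2 (Opens.mem_inf.1 hx).2) _ _
    · exact hempty (fun x hx => (CompactOpenDownset.mem_sdiff.1 (Opens.mem_inf.1 hx).2).2 (Opens.mem_inf.1 hx).1) _ _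
    · rfl
  obtain ⟨s, hs, hu⟩ := E.sheaf.existsUnique_gluing' U _ (fun t => homOfLE (iUV t)) hcov sf hcomp
  refine ⟨s, ⟨hs true, hs false⟩, fun t ht => hu t ?_⟩
  rintro (_ | _)
  · exact ht.2
  · exact ht.1

open Classical in
/-- The germ of `a` at `x`, if `x ∈ dom a`. -/
noncomputable def ev (x : E.base) (a : DualAlgebra E) :
    Option (TopCat.Presheaf.stalk E.presheaf (show TopCat.of E.base from x)) :=
  if h : x ∈ a.dom.toOpens then some (E.presheaf.germ a.dom.toOpens x h a.sec) else none

theorem ev_mem {x : E.base} {a : DualAlgebra E} (h : x ∈ a.dom.toOpens) :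
    ev x a = some (E.presheaf.germ a.dom.toOpens x h a.sec) := dif_pos h

theorem ev_notMem {x : E.base} {a : DualAlgebra E} (h : x ∉ a.dom.toOpens) :
    ev x a = none := dif_neg h

theorem ext_ev {a b : DualAlgebra E} (h : ∀ x, ev x a = ev x b) : a = b := by
  have hd : a.dom = b.dom := by
    refine CompactOpenDownset.ext (Opens.ext (Set.ext fun x => ?_))
    by_cases ha : x ∈ a.dom.toOpens <;> by_cases hb : x ∈ b.dom.toOpens
    · exact iff_of_true ha hb
    · have := h x; rw [ev_mem ha, ev_notMem hb] at this; cases this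
    · have := h x; rw [ev_mem hb, ev_notMem ha] at this; cases this
    · exact iff_of_false ha hb
  obtain ⟨U, s⟩ := a
  obtain ⟨V, t⟩ := b
  obtain rfl : U = V := hd
  congr 1
  refine TopCat.Presheaf.section_ext E.sheaf U.toOpens s t fun x hx => ?_
  have := h x
  rw [ev_mem (a := ⟨U, s⟩) hx, ev_mem (a := ⟨U, t⟩) hx] at this
  exact Option.some.inj this

theorem ev_res {a b : DualAlgebra E} {W : Opens E.base} (ha : W ≤ a.dom.toOpens) (hb : W ≤ b.dom.toOpens)
    (h : res ha a.sec = res hb b.sec) {x : E.base} (hx : x ∈ W) : ev x a = ev x b := by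
  rw [ev_mem (ha hx), ev_mem (hb hx)]
  have h1 := TopCat.Presheaf.germ_res_apply E.presheaf (homOfLE ha) x hx a.sec
  have h2 := TopCat.Presheaf.germ_res_apply E.presheaf (homOfLE hb) x hx b.sec
  rw [← h1, ← h2]
  exact congrArg _ (congrArg _ h)

/-- The override `a ∨ b`. -/
noncomputable instance : Max (DualAlgebra E) :=
  ⟨fun a b => ⟨a.dom.union b.dom, (existsUnique_override a b).choose⟩⟩

/-- The restriction `a ∧ b`, that is, `a|_{dom a ∩ dom b}`. -/
instance : Min (DualAlgebra E) :=
  ⟨fun a b => ⟨a.dom.inter b.dom, res (V := (a.dom.inter b.dom).toOpens) inf_le_left a.sec⟩⟩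

/-- The section over the empty set (it is unique, as `E` is a sheaf). -/
noncomputable instance : Zero (DualAlgebra E) :=
  ⟨⟨CompactOpenDownset.empty, (E.globalSupport _).some⟩⟩

theorem sup_spec (a b : DualAlgebra E) : IsOverride a b (a ⊔ b).sec :=
  (existsUnique_override a b).choose_spec.1

theorem ev_zero (x : E.base) : ev x (0 : DualAlgebra E) = none := ev_notMem fun h => h

theorem ev_inf_of_mem {a b : DualAlgebra E} {x : E.base} (h : x ∈ b.dom.toOpens) :
    ev x (a ⊓ b) = ev x a := by
  by_cases ha : x ∈ a.dom.toOpens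
  · refine ev_res (W := (a.dom.inter b.dom).toOpens) le_rfl inf_le_left ?_ ⟨ha, h⟩
    change E.presheaf.map (𝟙 _) _ = _
    rw [E.presheaf.map_id]
    rfl
  · rw [ev_notMem ha, ev_notMem fun k => ha (CompactOpenDownset.mem_inter.1 k).1]

theorem ev_inf_of_notMem {a b : DualAlgebra E} {x : E.base} (h : x ∉ b.dom.toOpens) :
    ev x (a ⊓ b) = none := ev_notMem fun k => h (CompactOpenDownset.mem_inter.1 k).2

theorem ev_sup_of_mem {a b : DualAlgebra E} {x : E.base} (h : x ∈ b.dom.toOpens) :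
    ev x (a ⊔ b) = ev x b := by
  refine ev_res (W := b.dom.toOpens) le_sup_right le_rfl ?_ h
  refine (sup_spec a b).1.trans ?_
  change _ = E.presheaf.map (𝟙 _) _
  rw [E.presheaf.map_id]
  rfl

theorem ev_sup_of_notMem {a b : DualAlgebra E} {x : E.base} (h : x ∉ b.dom.toOpens) :
    ev x (a ⊔ b) = ev x a := by
  by_cases ha : x ∈ a.dom.toOpens
  · exact ev_res (W := a.dom.sdiff b.dom) _ _ (sup_spec a b).2 ⟨ha, h⟩
  · rw [ev_notMem ha, ev_notMem fun k => (CompactOpenDownset.mem_union.1 k).elim ha h]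

theorem mem_inf {a b : DualAlgebra E} {x : E.base} :
    x ∈ (a ⊓ b).dom.toOpens ↔ x ∈ a.dom.toOpens ∧ x ∈ b.dom.toOpens := by
  exact CompactOpenDownset.mem_inter

theorem mem_sup {a b : DualAlgebra E} {x : E.base} :
    x ∈ (a ⊔ b).dom.toOpens ↔ x ∈ a.dom.toOpens ∨ x ∈ b.dom.toOpens := by
  exact CompactOpenDownset.mem_union

open Classical in
theorem ev_inf (a b : DualAlgebra E) (x : E.base) :
    ev x (a ⊓ b) = if x ∈ b.dom.toOpens then ev x a else none := by
  split_ifs with h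
  exacts [ev_inf_of_mem h, ev_inf_of_notMem h]

open Classical in
theorem ev_sup (a b : DualAlgebra E) (x : E.base) :
    ev x (a ⊔ b) = if x ∈ b.dom.toOpens then ev x b else ev x a := by
  split_ifs with h
  exacts [ev_sup_of_mem h, ev_sup_of_notMem h]

theorem notMem_zero (x : E.base) : x ∉ (0 : DualAlgebra E).dom.toOpens := fun h => h

noncomputable instance : SkewLattice (DualAlgebra E) where
  inf_assoc' a b c := ext_ev fun x => by
    grind [ev_inf, ev_sup, ev_zero, mem_inf, mem_sup, ev_notMem, notMem_zero]
  sup_assoc' a b c := ext_ev fun x => by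
    grind [ev_inf, ev_sup, ev_zero, mem_inf, mem_sup, ev_notMem, notMem_zero]
  inf_idem' a := ext_ev fun x => by
    grind [ev_inf, ev_sup, ev_zero, mem_inf, mem_sup, ev_notMem, notMem_zero]
  sup_idem' a := ext_ev fun x => by
    grind [ev_inf, ev_sup, ev_zero, mem_inf, mem_sup, ev_notMem, notMem_zero]
  inf_sup_absorb a b := ext_ev fun x => by
    grind [ev_inf, ev_sup, ev_zero, mem_inf, mem_sup, ev_notMem, notMem_zero]
  sup_inf_absorb a b := ext_ev fun x => by
    grind [ev_inf, ev_sup, ev_zero, mem_inf, mem_sup, ev_notMem, notMem_zero]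
  absorb_sup_inf a b := ext_ev fun x => by
    grind [ev_inf, ev_sup, ev_zero, mem_inf, mem_sup, ev_notMem, notMem_zero]
  absorb_inf_sup a b := ext_ev fun x => by
    grind [ev_inf, ev_sup, ev_zero, mem_inf, mem_sup, ev_notMem, notMem_zero]
  inf_zero' a := ext_ev fun x => by
    grind [ev_inf, ev_sup, ev_zero, mem_inf, mem_sup, ev_notMem, notMem_zero]
  zero_inf' a := ext_ev fun x => by
    grind [ev_inf, ev_sup, ev_zero, mem_inf, mem_sup, ev_notMem, notMem_zero]

instance : IsLeftHanded (DualAlgebra E) where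
  left_handed a b := ext_ev fun x => by
    grind [ev_inf, ev_sup, ev_zero, mem_inf, mem_sup, ev_notMem, notMem_zero]

instance : IsStronglyDistributive (DualAlgebra E) where
  inf_sup_distrib_left a b c := ext_ev fun x => by
    grind [ev_inf, ev_sup, ev_zero, mem_inf, mem_sup, ev_notMem, notMem_zero]
  inf_sup_distrib_right a b c := ext_ev fun x => by
    grind [ev_inf, ev_sup, ev_zero, mem_inf, mem_sup, ev_notMem, notMem_zero]

theorem dRel_iff_dom {a b : DualAlgebra E} : DRel a b ↔ a.dom = b.dom := by
  rw [dRel_iff_inf]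
  constructor
  · rintro ⟨h, k⟩
    refine CompactOpenDownset.ext (le_antisymm ?_ ?_)
    · rw [← h]; exact inf_le_right
    · rw [← k]; exact inf_le_right
  · intro h
    constructor <;> refine ext_ev fun x => ?_ <;> rw [ev_inf]
    · split_ifs with hx
      · rfl
      · rw [← h] at hx; exact (ev_notMem hx).symm
    · split_ifs with hx
      · rfl
      · rw [h] at hx; exact (ev_notMem hx).symm

theorem toReflection_le_iff_dom {a b : DualAlgebra E} :
    toReflection a ≤ toReflection b ↔ a.dom ≤ b.dom := by
  rw [toReflection_le_iff]
  constructor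
  · intro h
    rw [← h]
    exact (inf_le_right : a.dom.toOpens ⊓ b.dom.toOpens ≤ b.dom.toOpens)
  · intro h
    refine ext_ev fun x => ?_
    rw [ev_inf]
    split_ifs with hx
    · rfl
    · exact (ev_notMem fun k => hx (h k)).symm

/-- The isomorphism `E^⋆/𝒟 ≅ ℒ(X)` sending the class of a section to its domain. -/
noncomputable def reflectionIso (E : ShLPS.{u}) :
    LatticeReflection (DualAlgebra E) ≃o CompactOpenDownset E.base where
  toFun := Quotient.lift dom fun _ _ h => dRel_iff_dom.1 h
  invFun U := toReflection ⟨U, (E.globalSupport U.toOpens).some⟩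
  left_inv := by
    rintro ⟨a⟩
    exact toReflection_eq_iff.2 (dRel_iff_dom.2 rfl)
  right_inv _ := rfl
  map_rel_iff' := by
    rintro ⟨a⟩ ⟨b⟩
    exact toReflection_le_iff_dom.symm

theorem reflectionIso_toReflection (a : DualAlgebra E) :
    reflectionIso E (toReflection a) = a.dom := rfl

/-- `(f, λ)^⋆(a) = λ_U(a) ∈ E(f⁻¹(U))` for `a ∈ F(U)`. -/
def map (φ : E ⟶ F) (a : DualAlgebra F) : DualAlgebra E :=
  ⟨CompactOpenDownset.comap φ.base a.dom, φ.nat.app (op a.dom.toOpens) a.sec⟩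

theorem mem_map {φ : E ⟶ F} {a : DualAlgebra F} {x : E.base} :
    x ∈ (map φ a).dom.toOpens ↔ φ.base.toFun x ∈ a.dom.toOpens := Iff.rfl

theorem ev_map_congr (φ : E ⟶ F) {a b : DualAlgebra F} {x : E.base}
    (h : ev (φ.base.toFun x) a = ev (φ.base.toFun x) b) : ev x (map φ a) = ev x (map φ b) := by
  by_cases ha : φ.base.toFun x ∈ a.dom.toOpens <;> by_cases hb : φ.base.toFun x ∈ b.dom.toOpens
  · rw [ev_mem ha, ev_mem hb] at h
    obtain ⟨W, hW, ia, ib, e⟩ := TopCat.Presheaf.germ_eq F.presheaf _ ha hb _ _ (Option.some.inj h)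
    refine ev_res (W := (Opens.map (LPS.Hom.toTop φ.base)).obj W)
      (fun y hy => ia.le hy) (fun y hy => ib.le hy) ?_ hW
    have ka := NatTrans.naturality_apply φ.nat ia.op a.sec
    have kb := NatTrans.naturality_apply φ.nat ib.op b.sec
    rw [e] at ka
    exact ka.symm.trans kb
  · rw [ev_mem ha, ev_notMem hb] at h; cases h
  · rw [ev_mem hb, ev_notMem ha] at h; cases h
  · rw [ev_notMem (a := map φ a) ha, ev_notMem (a := map φ b) hb]

end DualAlgebra

/-- The object `E^⋆` of `DSL`. -/
noncomputable def starObj (E : ShLPS.{u}) : DSL.{u} := ⟨DualAlgebra E⟩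

/-- The homomorphism `(f, λ)^⋆ : F^⋆ → E^⋆`. -/
noncomputable def starHom {E F : ShLPS.{u}} (φ : E ⟶ F) :
    SkewHom (DualAlgebra F) (DualAlgebra E) where
  toFun := DualAlgebra.map φ
  map_inf' a b := DualAlgebra.ext_ev fun x => by
    rw [DualAlgebra.ev_inf]
    split_ifs with h
    · exact DualAlgebra.ev_map_congr φ (DualAlgebra.ev_inf_of_mem h)
    · exact DualAlgebra.ev_notMem fun k => h (CompactOpenDownset.mem_inter.1 k).2
  map_sup' a b := DualAlgebra.ext_ev fun x => by
    rw [DualAlgebra.ev_sup]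
    split_ifs with h
    · exact DualAlgebra.ev_map_congr φ (DualAlgebra.ev_sup_of_mem h)
    · exact DualAlgebra.ev_map_congr φ (DualAlgebra.ev_sup_of_notMem h)
  map_zero' := DualAlgebra.ext_ev fun x => by
    rw [DualAlgebra.ev_zero]
    exact DualAlgebra.ev_notMem fun k => k

theorem starHom_proper {E F : ShLPS.{u}} (φ : E ⟶ F) : IsProperLatticeHom (starHom φ).bar := by
  rintro ⟨a⟩
  obtain ⟨V, hV⟩ := F.base.exists_downset (a.dom.isCompact.image φ.base.continuous)
  refine ⟨toReflection ⟨V, (F.globalSupport V.toOpens).some⟩, ?_⟩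
  exact DualAlgebra.toReflection_le_iff_dom.2 fun x hx => hV ⟨x, hx, rfl⟩

/-- The contravariant functor `(-)^⋆ : Sh(LPS) → DSL`. -/
noncomputable def starFunctor : ShLPS.{u}ᵒᵖ ⥤ DSL.{u} where
  obj E := starObj E.unop
  map φ := ⟨starHom φ.unop, starHom_proper φ.unop⟩
  map_id _ := rfl
  map_comp _ _ := rfl

/-- `h̄ = ℒ(f)`, where `h : F^⋆ → E^⋆` and `f : X → Y`, under the identifications
`F^⋆/𝒟 ≅ ℒ(Y)` and `E^⋆/𝒟 ≅ ℒ(X)`. -/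
def BarEqComap {E F : ShLPS.{u}} (h : starObj F ⟶ starObj E) (f : E.base ⟶ F.base) : Prop :=
  ∀ q : LatticeReflection (DualAlgebra F),
    DualAlgebra.reflectionIso E (h.toSkewHom.bar q) =
      CompactOpenDownset.comap f (DualAlgebra.reflectionIso F q)

end SkewDuality

/-!
The functor is full and faithful because both parts of a morphism `(f, λ)` can be read off from its
action on sections over compact open downsets.

On bases, this is Priestley duality. Compact open downsets of a local Priestley space separate
points, and their differences `U \ V` form a basis (`LPS.exists_sdiff_le`). A proper homomorphism
`h : F^⋆ → E^⋆` induces `h̄ : ℒ(Y) → ℒ(X)`, and for each `x` the `U` with `x ∈ h̄(U)` form a proper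
nonempty prime filter, which by compactness consists of the `U` containing one point `f x`
(`LPS.exists_point_of_prime`). The map `f` so obtained is a morphism
(`LPS.exists_hom_of_preimage`), and the only one with `h̄ = ℒ(f)`.

On sheaves, everything is done on germs. If `a` and `b` have the same germ at `f x`, they agree on
some `U \ V` containing `f x`. For any sections `u` over `U` and `v` over `V` then
`(a ∧ u) ∨ v = (b ∧ u) ∨ v`, and applying `h` shows that `h a` and `h b` have the same germ at `x`
(`DualAlgebra.ev_congr_of_hom`). So `h` acts on germs. Every germ of `F` is the germ of an element
of `F^⋆`, since a section over the clopen set `U \ V` can be patched with any section over `V`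
(`DualAlgebra.exists_ev_eq_germAt`); gluing the images of germs gives `λ`
(`DualAlgebra.exists_nat_of_hom`). The same fact shows that `λ` is determined by its components at
compact open downsets.
-/

namespace SkewDuality

/-! ### Compact open downsets separate points and generate the topology -/

theorem LPS.exists_downset_of_not_le {X : LPS.{u}} {x y : X} (h : ¬ x ≤ y) :
    ∃ U : CompactOpenDownset X, y ∈ U.toOpens ∧ x ∉ U.toOpens := by
  have := X.isLocalPriestley.2
  obtain ⟨W, hW1, hW2, hW3, hW4⟩ :=
    exists_isClopen_lower_of_not_le (mt onePoint_coe_le_coe.1 h)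
  have hinf : (∞ : OnePoint X) ∉ W := fun k => hW3 (hW2 (onePoint_le_infty _) k)
  exact ⟨⟨⟨((↑) : X → OnePoint X) ⁻¹' W, hW1.isOpen.preimage OnePoint.continuous_coe⟩,
    ((OnePoint.isClosed_iff_of_notMem hinf).1 hW1.isClosed).2,
    fun a b k hb => hW2 (onePoint_coe_le_coe.2 k) hb⟩, hW4, hW3⟩

theorem LPS.exists_mem_downset {X : LPS.{u}} (x : X) :
    ∃ U : CompactOpenDownset X, x ∈ U.toOpens := by
  obtain ⟨U, hU⟩ := X.exists_downset (isCompact_singleton (x := x))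
  exact ⟨U, hU rfl⟩

theorem LPS.eq_of_forall_mem_downset_iff {X : LPS.{u}} {x y : X}
    (h : ∀ U : CompactOpenDownset X, x ∈ U.toOpens ↔ y ∈ U.toOpens) : x = y := by
  refine le_antisymm ?_ ?_ <;> by_contra hn
  · obtain ⟨U, h1, h2⟩ := LPS.exists_downset_of_not_le hn
    exact h2 ((h U).2 h1)
  · obtain ⟨U, h1, h2⟩ := LPS.exists_downset_of_not_le hn
    exact h2 ((h U).1 h1)

theorem CompactOpenDownset.isClopen {X : LPS.{u}} (U : CompactOpenDownset X) :
    IsClopen (U.toOpens : Set X) := by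
  have := X.t2
  exact ⟨U.isCompact.isClosed, U.toOpens.isOpen⟩

/-- The differences of compact open downsets form a basis of the topology. -/
theorem LPS.exists_sdiff_le {X : LPS.{u}} {x : X} {W : Opens X} (hx : x ∈ W) :
    ∃ U V : CompactOpenDownset X, x ∈ U.sdiff V ∧ U.sdiff V ≤ W := by
  obtain ⟨U₀, hU₀⟩ := LPS.exists_mem_downset x
  have hK : IsCompact ((U₀.toOpens : Set X) \ W) := U₀.isCompact.diff W.isOpen
  -- By compactness it is enough to separate `x` from each point of `U₀ \ W`.
  have key : ∃ U V : CompactOpenDownset X, x ∈ U.toOpens ∧ x ∉ V.toOpens ∧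
      ((U₀.toOpens : Set X) \ W) ∩ U.toOpens ⊆ (V.toOpens : Set X) := by
    refine hK.induction_on (p := fun s => ∃ U V : CompactOpenDownset X, x ∈ U.toOpens ∧
      x ∉ V.toOpens ∧ s ∩ U.toOpens ⊆ (V.toOpens : Set X)) ?_ ?_ ?_ ?_
    · exact ⟨U₀, .empty, hU₀, fun h => h, by simp⟩
    · rintro s t hst ⟨U, V, h1, h2, h3⟩
      exact ⟨U, V, h1, h2, (Set.inter_subset_inter_left _ hst).trans h3⟩
    · rintro s t ⟨U, V, h1, h2, h3⟩ ⟨U', V', h1', h2', h3'⟩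
      refine ⟨U.inter U', V.union V', ⟨h1, h1'⟩, fun h => h.elim h2 h2', ?_⟩
      rintro z ⟨hz | hz, hU, hU'⟩
      · exact Or.inl (h3 ⟨hz, hU⟩)
      · exact Or.inr (h3' ⟨hz, hU'⟩)
    · rintro z ⟨-, hz⟩
      by_cases hzx : z ≤ x
      · have hxz : ¬ x ≤ z := fun h => hz (le_antisymm hzx h ▸ hx)
        obtain ⟨V, hV, hV'⟩ := LPS.exists_downset_of_not_le hxz
        exact ⟨V.toOpens, mem_nhdsWithin_of_mem_nhds (V.toOpens.isOpen.mem_nhds hV),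
          U₀, V, hU₀, hV', Set.inter_subset_left⟩
      · obtain ⟨U, hU, hU'⟩ := LPS.exists_downset_of_not_le hzx
        exact ⟨(U.toOpens : Set X)ᶜ,
          mem_nhdsWithin_of_mem_nhds (U.isClopen.compl.isOpen.mem_nhds hU'),
          U, .empty, hU, fun h => h, fun y hy => absurd hy.2 hy.1⟩
  obtain ⟨U, V, h1, h2, h3⟩ := key
  refine ⟨U.inter U₀, V, ⟨⟨h1, hU₀⟩, h2⟩, fun z hz => ?_⟩
  by_contra hzW
  exact hz.2 (h3 ⟨⟨hz.1.2, hzW⟩, hz.1.1⟩)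

/-! ### Morphisms from lattice homomorphisms -/

theorem LPS.Hom.eq_of_comap_eq {X Y : LPS.{u}} {f g : X ⟶ Y}
    (h : ∀ U, CompactOpenDownset.comap f U = CompactOpenDownset.comap g U) : f = g := by
  refine LPS.Hom.ext (funext fun x => LPS.eq_of_forall_mem_downset_iff fun U => ?_)
  change x ∈ (CompactOpenDownset.comap f U).toOpens ↔ x ∈ (CompactOpenDownset.comap g U).toOpens
  rw [h]

/-- A prime filter of compact open downsets is the filter of neighbourhoods of a point in
`ℒ(Y)`. -/
theorem LPS.exists_point_of_prime {Y : LPS.{u}} (P : CompactOpenDownset Y → Prop)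
    (hne : ∃ U, P U) (hbot : ¬ P .empty)
    (hinf : ∀ U V, P (U.inter V) ↔ P U ∧ P V) (hsup : ∀ U V, P (U.union V) ↔ P U ∨ P V) :
    ∃ y : Y, ∀ U, y ∈ U.toOpens ↔ P U := by
  have hmono : ∀ {U V : CompactOpenDownset Y}, P U → (U.toOpens : Set Y) ⊆ V.toOpens → P V := by
    intro U V hU hUV
    have : U.inter V = U := CompactOpenDownset.ext (inf_eq_left.2 hUV)
    exact ((hinf U V).1 (this.symm ▸ hU)).2
  obtain ⟨U₀, hU₀⟩ := hne
  -- The sets `U \ V` with `U` in the filter and `V` outside it are nonempty and directed, and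
  -- a point in all of them is as required.
  let ι := {p : CompactOpenDownset Y × CompactOpenDownset Y // P p.1 ∧ ¬ P p.2}
  let t : ι → Set Y := fun p => (p.1.1.toOpens : Set Y) \ p.1.2.toOpens
  have : Nonempty ι := ⟨⟨(U₀, .empty), hU₀, hbot⟩⟩
  obtain ⟨y, hy⟩ : (⋂ i, t i).Nonempty := by
    refine IsCompact.nonempty_iInter_of_directed_nonempty_isCompact_isClosed t ?_ ?_ ?_ ?_
    · rintro ⟨⟨U, V⟩, hU, hV⟩ ⟨⟨U', V'⟩, hU', hV'⟩
      refine ⟨⟨(U.inter U', V.union V'), (hinf _ _).2 ⟨hU, hU'⟩, fun h =>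
        ((hsup _ _).1 h).elim hV hV'⟩, ?_, ?_⟩
      · exact fun z hz => ⟨hz.1.1, fun h => hz.2 (Or.inl h)⟩
      · exact fun z hz => ⟨hz.1.2, fun h => hz.2 (Or.inr h)⟩
    · rintro ⟨⟨U, V⟩, hU, hV⟩
      by_contra hn
      rw [Set.not_nonempty_iff_eq_empty, Set.sdiff_eq_empty] at hn
      exact hV (hmono hU hn)
    · rintro ⟨⟨U, V⟩, hU, hV⟩
      exact U.isCompact.diff V.toOpens.isOpen
    · rintro ⟨⟨U, V⟩, hU, hV⟩
      exact (U.isClopen.diff V.isClopen).isClosed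
  rw [Set.mem_iInter] at hy
  refine ⟨y, fun U => ⟨fun h => ?_, fun h => (hy ⟨(U, .empty), h, hbot⟩).1⟩⟩
  by_contra hU
  exact (hy ⟨(U₀, U), hU₀, hU⟩).2 h

/-- A map pulling compact open downsets back to compact open downsets is a morphism: it is
continuous and monotone because these sets generate the topology and determine the order, and it
extends continuously by `∞ ↦ ∞` because they are cofinal among the compact sets. -/
theorem LPS.exists_hom_of_preimage {X Y : LPS.{u}} (f : X → Y)
    (k : CompactOpenDownset Y → CompactOpenDownset X)
    (hf : ∀ U x, f x ∈ U.toOpens ↔ x ∈ (k U).toOpens) :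
    ∃ g : X ⟶ Y, ∀ U, CompactOpenDownset.comap g U = k U := by
  have hpre : ∀ U : CompactOpenDownset Y, f ⁻¹' (U.toOpens : Set Y) = (k U).toOpens :=
    fun U => Set.ext (hf U)
  have hcont : Continuous f := by
    refine continuous_iff_continuousAt.2 fun x => ?_
    intro S hS
    obtain ⟨W, hWS, hW, hxW⟩ := mem_nhds_iff.1 hS
    obtain ⟨U, V, h1, h2⟩ := LPS.exists_sdiff_le (W := ⟨W, hW⟩) hxW
    have ho : IsOpen (f ⁻¹' ((U.toOpens : Set Y) \ V.toOpens)) := by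
      rw [Set.preimage_sdiff, hpre, hpre]
      exact ((k U).isClopen.diff (k V).isClopen).isOpen
    exact Filter.mem_of_superset (ho.mem_nhds h1) fun z hz => hWS (h2 hz)
  have hmono : Monotone f := by
    intro x y hxy
    by_contra hn
    obtain ⟨U, hU, hU'⟩ := LPS.exists_downset_of_not_le hn
    exact hU' ((hf U x).2 ((k U).isLowerSet hxy ((hf U y).1 hU)))
  have hproper : Filter.Tendsto f (Filter.coclosedCompact X) (Filter.coclosedCompact Y) := by
    refine (Filter.hasBasis_coclosedCompact.tendsto_iff Filter.hasBasis_coclosedCompact).2 ?_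
    rintro K ⟨hK, hK'⟩
    obtain ⟨U, hU⟩ := Y.exists_downset hK'
    have hc := (k U).isCompact
    rw [← hpre] at hc
    exact ⟨f ⁻¹' K, ⟨hK.preimage hcont, hc.of_isClosed_subset (hK.preimage hcont)
      (Set.preimage_mono hU)⟩, fun z hz => hz⟩
  refine ⟨⟨f, OnePoint.map f, OnePoint.continuous_map hcont hproper, ?_, ?_, fun x => rfl⟩,
    fun U => CompactOpenDownset.ext (Opens.ext (hpre U))⟩
  · rintro p q (rfl | ⟨x, y, rfl, rfl, h⟩)
    · exact onePoint_le_infty _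
    · exact onePoint_coe_le_coe.2 (hmono h)
  · ext p
    induction p using OnePoint.rec with
    | infty => simp
    | coe x => simp

namespace DualAlgebra

variable {E F : ShLPS.{u}}

/-! ### Germs of sections under a homomorphism -/

/-- Sections over a compact open downset exist, by global support. -/
theorem exists_dom_eq (U : CompactOpenDownset E.base) : ∃ a : DualAlgebra E, a.dom = U :=
  ⟨⟨U, (E.globalSupport U.toOpens).some⟩, rfl⟩

theorem ev_eq_none_iff {x : E.base} {a : DualAlgebra E} : ev x a = none ↔ x ∉ a.dom.toOpens := by
  by_cases h : x ∈ a.dom.toOpens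
  · simp [ev_mem h, h]
  · simp [ev_notMem h, h]

/-- The stalk of `E` at `x`. -/
abbrev Stalk (E : ShLPS.{u}) (x : E.base) : Type u :=
  TopCat.Presheaf.stalk E.presheaf (show TopCat.of E.base from x)

/-- The germ of a section at a point. -/
noncomputable def germAt {W : Opens E.base} (s : E.presheaf.obj (op W)) (x : E.base) (hx : x ∈ W) :
    Stalk E x :=
  E.presheaf.germ W x hx s

theorem ev_eq_some_germAt {a : DualAlgebra E} {x : E.base} (h : x ∈ a.dom.toOpens) :
    ev x a = some (germAt a.sec x h) := ev_mem h

theorem mem_dom_of_ev_eq_some {a : DualAlgebra E} {x : E.base} {g : Stalk E x}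
    (h : ev x a = some g) : x ∈ a.dom.toOpens := by
  by_contra hn
  exact absurd (h.symm.trans (ev_notMem hn)) (Option.some_ne_none _)

theorem germAt_res {W N : Opens E.base} (h : N ≤ W) (s : E.presheaf.obj (op W)) {x : E.base}
    (hx : x ∈ N) : germAt (res h s) x hx = germAt s x (h hx) :=
  TopCat.Presheaf.germ_res_apply E.presheaf (homOfLE h) x hx s

theorem section_ext {W : Opens E.base} {s t : E.presheaf.obj (op W)}
    (h : ∀ x hx, germAt s x hx = germAt t x hx) : s = t :=
  TopCat.Presheaf.section_ext E.sheaf W s t h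

theorem exists_res_eq_of_germAt_eq {U V : Opens E.base} {s : E.presheaf.obj (op U)}
    {t : E.presheaf.obj (op V)} {x : E.base} {hU : x ∈ U} {hV : x ∈ V}
    (h : germAt s x hU = germAt t x hV) :
    ∃ (W : Opens E.base) (_ : x ∈ W) (iU : W ≤ U) (iV : W ≤ V), res iU s = res iV t := by
  obtain ⟨W, hW, iU, iV, e⟩ := TopCat.Presheaf.germ_eq E.presheaf _ hU hV _ _ h
  exact ⟨W, hW, iU.le, iV.le, e⟩

/-- A family of germs that is locally given by sections is the family of germs of a section. -/
theorem exists_section_of_germs {W : Opens E.base} (e : ∀ x, x ∈ W → Stalk E x)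
    (h : ∀ x, x ∈ W → ∃ (N : Opens E.base) (s : E.presheaf.obj (op N)), x ∈ N ∧
      ∀ y (hy : y ∈ N) (hW : y ∈ W), germAt s y hy = e y hW) :
    ∃ t : E.presheaf.obj (op W), ∀ x hx, germAt t x hx = e x hx := by
  choose N s hN hs using h
  let O : W → Opens E.base := fun x => N x x.2 ⊓ W
  let sf : ∀ x : W, E.presheaf.obj (op (O x)) := fun x => res inf_le_left (s x x.2)
  have hsf : ∀ (x : W) (y : E.base) (hy : y ∈ O x), germAt (sf x) y hy = e y hy.2 := by
    intro x y hy
    rw [germAt_res, hs]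
  have hcomp : TopCat.Presheaf.IsCompatible E.sheaf.1 O sf := by
    intro x y
    refine section_ext fun z hz => ?_
    exact ((germAt_res (h := inf_le_left) (sf x) hz).trans (hsf x z hz.1)).trans
      ((germAt_res (h := inf_le_right) (sf y) hz).trans (hsf y z hz.2)).symm
  obtain ⟨t, ht, -⟩ := E.sheaf.existsUnique_gluing' O W (fun x => homOfLE inf_le_right)
    (fun x hx => Opens.mem_iSup.2 ⟨⟨x, hx⟩, hN x hx, hx⟩) sf hcomp
  refine ⟨t, fun x hx => ?_⟩
  have hxO : x ∈ O ⟨x, hx⟩ := ⟨hN x hx, hx⟩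
  rw [← hsf ⟨x, hx⟩ x hxO, ← ht ⟨x, hx⟩]
  exact (germAt_res (h := inf_le_right) t hxO).symm

/-- Every section over an open set agrees near each point with an element of the dual algebra: over
a basic open set `U \ V` it can be patched with a section over `V`. -/
theorem exists_ev_eq_germAt {W : Opens E.base} (s : E.presheaf.obj (op W)) {x : E.base}
    (hx : x ∈ W) : ∃ (a : DualAlgebra E) (N : Opens E.base) (_ : x ∈ N) (hN : N ≤ W),
      ∀ y (hy : y ∈ N), ev y a = some (germAt s y (hN hy)) := by
  classical
  obtain ⟨U, V, hxUV, hUV⟩ := LPS.exists_sdiff_le hx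
  obtain ⟨t⟩ := E.globalSupport V.toOpens
  have hW : ∀ {y}, y ∈ (U.union V).toOpens → y ∉ V.toOpens → y ∈ W :=
    fun hy hV => hUV ⟨hy.resolve_right hV, hV⟩
  obtain ⟨r, hr⟩ := exists_section_of_germs (W := (U.union V).toOpens)
    (fun y hy => if hV : y ∈ V.toOpens then germAt t y hV else germAt s y (hW hy hV)) (by
      intro y hy
      by_cases hV : y ∈ V.toOpens
      · exact ⟨V.toOpens, t, hV, fun z hz _ => by rw [dif_pos hz]⟩
      · exact ⟨U.sdiff V, res hUV s, ⟨hy.resolve_right hV, hV⟩, fun z hz _ => by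
          rw [dif_neg (show z ∉ V.toOpens from hz.2), germAt_res]⟩)
  refine ⟨⟨U.union V, r⟩, U.sdiff V, hxUV, hUV, fun y hy => ?_⟩
  have hy' : y ∈ (U.union V).toOpens := Or.inl hy.1
  rw [ev_eq_some_germAt (a := ⟨U.union V, r⟩) hy', hr, dif_neg (show y ∉ V.toOpens from hy.2)]

/-- The germ of `h a` at `x` depends only on the germ of `a` at `f x`. -/
theorem ev_congr_of_hom {h : SkewHom (DualAlgebra F) (DualAlgebra E)} {f : E.base ⟶ F.base}
    (hf : ∀ a, (h.toFun a).dom = CompactOpenDownset.comap f a.dom) {a b : DualAlgebra F}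
    {x : E.base} (hab : ev (f.toFun x) a = ev (f.toFun x) b) :
    ev x (h.toFun a) = ev x (h.toFun b) := by
  have hmem : ∀ c, x ∈ (h.toFun c).dom.toOpens ↔ f.toFun x ∈ c.dom.toOpens :=
    fun c => by rw [hf]; rfl
  by_cases ha : f.toFun x ∈ a.dom.toOpens
  · have hb : f.toFun x ∈ b.dom.toOpens := by
      by_contra hb
      exact ev_eq_none_iff.1 (hab.trans (ev_notMem hb)) ha
    rw [ev_eq_some_germAt ha, ev_eq_some_germAt hb] at hab
    obtain ⟨W, hxW, ia, ib, e⟩ := exists_res_eq_of_germAt_eq (Option.some.inj hab)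
    obtain ⟨U, V, hxUV, hUV⟩ := LPS.exists_sdiff_le hxW
    obtain ⟨u, rfl⟩ := exists_dom_eq U
    obtain ⟨v, rfl⟩ := exists_dom_eq V
    -- `a` and `b` agree on `U \ V`, so restricting to `U` and overriding on `V` equates them.
    have key : (a ⊓ u) ⊔ v = (b ⊓ u) ⊔ v := by
      refine ext_ev fun y => ?_
      by_cases hv : y ∈ v.dom.toOpens
      · rw [ev_sup_of_mem hv, ev_sup_of_mem hv]
      rw [ev_sup_of_notMem hv, ev_sup_of_notMem hv]
      by_cases hu : y ∈ u.dom.toOpens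
      · rw [ev_inf_of_mem hu, ev_inf_of_mem hu]
        exact ev_res ia ib e (hUV ⟨hu, hv⟩)
      · rw [ev_inf_of_notMem hu, ev_inf_of_notMem hu]
    have hu : x ∈ (h.toFun u).dom.toOpens := (hmem u).2 hxUV.1
    have hv : x ∉ (h.toFun v).dom.toOpens := mt (hmem v).1 hxUV.2
    have := congrArg (fun c => ev x (h.toFun c)) key
    simpa only [h.map_sup', h.map_inf', ev_sup_of_notMem hv, ev_inf_of_mem hu] using this
  · have hb : f.toFun x ∉ b.dom.toOpens := ev_eq_none_iff.1 (hab.symm.trans (ev_notMem ha))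
    rw [ev_notMem (mt (hmem a).1 ha), ev_notMem (mt (hmem b).1 hb)]

/-! ### Natural transformations are determined by germs -/

/-- The germ of `λ s` at `x` depends only on the germ of `s` at `f x`. -/
theorem germAt_app_congr {f : E.base ⟶ F.base} (l : F.presheaf ⟶ directImage f E.presheaf)
    {U V : Opens F.base} {s : F.presheaf.obj (op U)} {t : F.presheaf.obj (op V)} {x : E.base}
    {hU : f.toFun x ∈ U} {hV : f.toFun x ∈ V}
    (h : germAt s (f.toFun x) hU = germAt t (f.toFun x) hV) :
    germAt (W := (Opens.map (LPS.Hom.toTop f)).obj U) (l.app (op U) s) x hU =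
      germAt (W := (Opens.map (LPS.Hom.toTop f)).obj V) (l.app (op V) t) x hV := by
  obtain ⟨W, hW, iU, iV, e⟩ := exists_res_eq_of_germAt_eq h
  have kU := NatTrans.naturality_apply l (homOfLE iU).op s
  have kV := NatTrans.naturality_apply l (homOfLE iV).op t
  have e' : F.presheaf.map (homOfLE iU).op s = F.presheaf.map (homOfLE iV).op t := e
  rw [e'] at kU
  have h1 := germAt_res (W := (Opens.map (LPS.Hom.toTop f)).obj U)
    (N := (Opens.map (LPS.Hom.toTop f)).obj W) (fun y hy => iU hy) (l.app (op U) s)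
    (x := x) hW
  have h2 := germAt_res (W := (Opens.map (LPS.Hom.toTop f)).obj V)
    (N := (Opens.map (LPS.Hom.toTop f)).obj W) (fun y hy => iV hy) (l.app (op V) t)
    (x := x) hW
  rw [← h1, ← h2]
  exact congrArg (fun r => germAt r x hW) (kU.symm.trans kV)

/-- Transformations agree if every germ has a representative on which they agree. -/
theorem nat_ext {f : E.base ⟶ F.base} {l m : F.presheaf ⟶ directImage f E.presheaf}
    (h : ∀ (W : Opens F.base) (s : F.presheaf.obj (op W)) (y : F.base) (hy : y ∈ W),
      ∃ (U : Opens F.base) (t : F.presheaf.obj (op U)) (hU : y ∈ U),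
        germAt s y hy = germAt t y hU ∧ l.app (op U) t = m.app (op U) t) : l = m := by
  refine NatTrans.ext (funext fun W => ?_)
  ext s
  refine section_ext (W := (Opens.map (LPS.Hom.toTop f)).obj W.unop) fun x hx => ?_
  obtain ⟨U, t, hU, hst, e⟩ := h W.unop s (f.toFun x) hx
  refine (germAt_app_congr l hst).trans (Eq.trans ?_ (germAt_app_congr m hst).symm)
  rw [e]

theorem nat_ext_compactOpenDownset {f : E.base ⟶ F.base}
    {l m : F.presheaf ⟶ directImage f E.presheaf}
    (h : ∀ U : CompactOpenDownset F.base, l.app (op U.toOpens) = m.app (op U.toOpens)) :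
    l = m := by
  refine nat_ext fun W s y hy => ?_
  obtain ⟨a, N, hyN, hN, ha⟩ := exists_ev_eq_germAt s hy
  have hya : y ∈ a.dom.toOpens := mem_dom_of_ev_eq_some (ha y hyN)
  refine ⟨a.dom.toOpens, a.sec, hya, Option.some.inj ?_, by rw [h]⟩
  rw [← ha y hyN, ev_eq_some_germAt hya]

theorem nat_ext_basis {f : E.base ⟶ F.base} {l m : F.presheaf ⟶ directImage f E.presheaf}
    {B : Set (Opens F.base)} (hB : Opens.IsBasis B)
    (h : ∀ U ∈ B, l.app (op U) = m.app (op U)) : l = m := by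
  refine nat_ext fun W s y hy => ?_
  obtain ⟨U, hU, hyU, hUW⟩ := Opens.isBasis_iff_nbhd.1 hB hy
  exact ⟨U, res hUW s, hyU, (germAt_res hUW s hyU).symm, by rw [h U hU]⟩

/-! ### The morphism of sheaves induced by a homomorphism of dual algebras -/

/-- A homomorphism of dual algebras lying over `f` is induced by a natural transformation. -/
theorem exists_nat_of_hom (h : SkewHom (DualAlgebra F) (DualAlgebra E)) (f : E.base ⟶ F.base)
    (hf : ∀ a, (h.toFun a).dom = CompactOpenDownset.comap f a.dom) :
    ∃ l : F.presheaf ⟶ directImage f E.presheaf, ∀ a, map ⟨f, l⟩ a = h.toFun a := by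
  have hmem : ∀ c x, x ∈ (h.toFun c).dom.toOpens ↔ f.toFun x ∈ c.dom.toOpens :=
    fun c x => by rw [hf]; rfl
  let pre : Opens F.base → Opens E.base := fun W => (Opens.map (LPS.Hom.toTop f)).obj W
  -- The value `t` of the transformation at `s` is characterized on germs.
  let Im : ∀ (W : Opens F.base), F.presheaf.obj (op W) → E.presheaf.obj (op (pre W)) → Prop :=
    fun W s t => ∀ (x : E.base) (hx : f.toFun x ∈ W) (a : DualAlgebra F),
      ev (f.toFun x) a = some (germAt s (f.toFun x) hx) → ev x (h.toFun a) = some (germAt t x hx)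
  have huniq : ∀ W s t t', Im W s t → Im W s t' → t = t' := by
    intro W s t t' ht ht'
    refine section_ext fun x hx => Option.some.inj ?_
    obtain ⟨a, N, hN, hNW, ha⟩ := exists_ev_eq_germAt s (x := f.toFun x) hx
    rw [← ht x hx a (ha _ hN), ht' x hx a (ha _ hN)]
  have hex : ∀ W s, ∃ t, Im W s t := by
    intro W s
    have hgerm : ∀ x (hx : x ∈ pre W), ∃ e : Stalk E x, ∀ a,
        ev (f.toFun x) a = some (germAt s (f.toFun x) hx) → ev x (h.toFun a) = some e := by
      intro x hx
      obtain ⟨a, N, hN, hNW, ha⟩ := exists_ev_eq_germAt s (x := f.toFun x) hx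
      have hxa : x ∈ (h.toFun a).dom.toOpens := (hmem a x).2 (mem_dom_of_ev_eq_some (ha _ hN))
      refine ⟨germAt (h.toFun a).sec x hxa, fun b hb => ?_⟩
      rw [ev_congr_of_hom hf (hb.trans (ha _ hN).symm), ev_eq_some_germAt hxa]
    choose e he using hgerm
    obtain ⟨t, ht⟩ := exists_section_of_germs e (by
      intro x hx
      obtain ⟨a, N, hN, hNW, ha⟩ := exists_ev_eq_germAt s (x := f.toFun x) hx
      refine ⟨pre N ⊓ (h.toFun a).dom.toOpens, res inf_le_right (h.toFun a).sec, 
        ⟨hN, (hmem a x).2 (mem_dom_of_ev_eq_some (ha _ hN))⟩, fun y hy hyW => ?_⟩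
      rw [germAt_res]
      exact Option.some.inj ((ev_eq_some_germAt hy.2).symm.trans (he y hyW a (ha _ hy.1))))
    refine ⟨t, fun x hx a ha => ?_⟩
    exact (he x hx a ha).trans (congrArg some (ht x hx).symm)
  choose lam hlam using hex
  let l : F.presheaf ⟶ directImage f E.presheaf :=
    { app := fun W => TypeCat.ofHom (lam W.unop)
      naturality := by
        intro W W' i
        ext s
        refine huniq W'.unop (res i.unop.le s) _ _ (hlam _ _) ?_
        intro x hx a ha
        have h1 := hlam W.unop s x (i.unop.le hx) a (by rw [ha, germAt_res])
        rw [h1]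
        exact congrArg some (germAt_res (W := pre W.unop) (N := pre W'.unop)
          (fun y hy => i.unop.le hy) (lam W.unop s) hx).symm }
  refine ⟨l, fun a => ext_ev fun x => ?_⟩
  by_cases hx : f.toFun x ∈ a.dom.toOpens
  · rw [hlam a.dom.toOpens a.sec x hx a (ev_eq_some_germAt hx)]
    exact ev_eq_some_germAt (a := map ⟨f, l⟩ a) hx
  · rw [ev_notMem (mt (hmem a x).1 hx)]
    exact ev_notMem hx

end DualAlgebra

open DualAlgebra

/-! ### Fullness and faithfulness -/

/-- For `x ∈ X`, the `U ∈ ℒ(Y)` with `x ∈ h̄(U)` form a prime filter, which is nonempty because `h`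
is proper; the point of `Y` it determines is `f x`. -/
theorem exists_barEqComap {E F : ShLPS.{u}} (h : starObj F ⟶ starObj E) :
    ∃ f : E.base ⟶ F.base, BarEqComap h f := by
  let g : SkewHom (DualAlgebra F) (DualAlgebra E) := h.toSkewHom
  let k : CompactOpenDownset F.base → CompactOpenDownset E.base := fun U =>
    reflectionIso E (g.bar ((reflectionIso F).symm U))
  have hk : ∀ a : DualAlgebra F, k a.dom = (g.toFun a).dom := by
    intro a
    change reflectionIso E (g.bar ((reflectionIso F).symm (reflectionIso F (toReflection a)))) = _
    rw [OrderIso.symm_apply_apply]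
    rfl
  have hpt : ∀ x : E.base, ∃ y : F.base, ∀ U, y ∈ U.toOpens ↔ x ∈ (k U).toOpens := by
    intro x
    refine LPS.exists_point_of_prime (fun U => x ∈ (k U).toOpens) ?_ ?_ ?_ ?_
    · obtain ⟨V, hV⟩ := LPS.exists_mem_downset x
      obtain ⟨b, rfl⟩ := exists_dom_eq V
      obtain ⟨⟨a⟩, ha⟩ := h.proper (toReflection b)
      exact ⟨dom (E := F) a, (hk a).symm ▸ toReflection_le_iff_dom.1 ha hV⟩
    · have : k (.empty) = (g.toFun 0).dom := hk 0
      rw [this, g.map_zero']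
      exact notMem_zero x
    · intro U V
      obtain ⟨a, rfl⟩ := exists_dom_eq U
      obtain ⟨b, rfl⟩ := exists_dom_eq V
      have : k (a.dom.inter b.dom) = (g.toFun (a ⊓ b)).dom := hk (a ⊓ b)
      rw [this, g.map_inf', mem_inf, hk, hk]
    · intro U V
      obtain ⟨a, rfl⟩ := exists_dom_eq U
      obtain ⟨b, rfl⟩ := exists_dom_eq V
      have : k (a.dom.union b.dom) = (g.toFun (a ⊔ b)).dom := hk (a ⊔ b)
      rw [this, g.map_sup', mem_sup, hk, hk]
  choose f hf using hpt
  obtain ⟨f', hf'⟩ := LPS.exists_hom_of_preimage f k fun U x => hf x U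
  refine ⟨f', fun q => ?_⟩
  rw [hf']
  change _ = reflectionIso E (g.bar ((reflectionIso F).symm (reflectionIso F q)))
  rw [OrderIso.symm_apply_apply]
  rfl

theorem BarEqComap.unique {E F : ShLPS.{u}} {h : starObj F ⟶ starObj E} {f g : E.base ⟶ F.base}
    (hf : BarEqComap h f) (hg : BarEqComap h g) : f = g := by
  refine LPS.Hom.eq_of_comap_eq fun U => ?_
  have := (hf ((reflectionIso F).symm U)).symm.trans (hg _)
  rwa [OrderIso.apply_symm_apply] at this

theorem barEqComap_map {E F : ShLPS.{u}} (φ : E ⟶ F) :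
    BarEqComap (starFunctor.map φ.op : starObj F ⟶ starObj E) φ.base := by
  rintro ⟨a⟩
  rfl

theorem exists_map_eq {E F : ShLPS.{u}} (h : starObj F ⟶ starObj E) :
    ∃ φ : E ⟶ F, (starFunctor.map φ.op : starObj F ⟶ starObj E) = h := by
  obtain ⟨f, hf⟩ := exists_barEqComap h
  obtain ⟨l, hl⟩ := exists_nat_of_hom h.toSkewHom f fun a => hf (toReflection a)
  exact ⟨⟨f, l⟩, DSL.Hom.ext (funext hl)⟩

theorem map_injective {E F : ShLPS.{u}} {φ ψ : E ⟶ F}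
    (h : (starFunctor.map φ.op : starObj F ⟶ starObj E) = starFunctor.map ψ.op) : φ = ψ := by
  have hb : φ.base = ψ.base := (barEqComap_map φ).unique (h ▸ barEqComap_map ψ)
  obtain ⟨f, l⟩ := φ
  obtain ⟨g, m⟩ := ψ
  obtain rfl : f = g := hb
  have : l = m := nat_ext_compactOpenDownset fun U => by
    ext s
    have e : map (⟨f, l⟩ : E ⟶ F) ⟨U, s⟩ = map (⟨f, m⟩ : E ⟶ F) ⟨U, s⟩ :=
      congrFun (congrArg (fun k => k.toFun) h) ⟨U, s⟩
    exact eq_of_heq (DualAlgebra.mk.inj e).2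
  rw [this]

end SkewDuality

theorem proposition7p1 :
    (SkewDuality.starFunctor.{u}).Full ∧ (SkewDuality.starFunctor.{u}).Faithful ∧
    ∀ E F : SkewDuality.ShLPS.{u},
      -- `(f, λ) ↦ (f, λ)^⋆` is a bijection `Hom(E, F) → Hom(F^⋆, E^⋆)`
      Function.Bijective (fun φ : E ⟶ F =>
        (SkewDuality.starFunctor.map φ.op : SkewDuality.starObj F ⟶ SkewDuality.starObj E)) ∧
      -- every `h : F^⋆ → E^⋆` is `(f, λ)^⋆` for a unique `(f, λ)`; here `f` is the unique
      -- morphism with `h̄ = ℒ(f)`, and `λ_U(s) = h(s)` for all `s ∈ F(U)`, `U ∈ ℒ(Y)`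
      (∀ h : SkewDuality.starObj F ⟶ SkewDuality.starObj E,
        ∃ φ : E ⟶ F, SkewDuality.starFunctor.map φ.op = h ∧
          (∀ ψ : E ⟶ F, SkewDuality.starFunctor.map ψ.op = h → ψ = φ) ∧
          (∀ f : E.base ⟶ F.base, SkewDuality.BarEqComap h f ↔ f = φ.base) ∧
          ∀ (U : SkewDuality.CompactOpenDownset F.base) (s : F.presheaf.obj (op U.toOpens)),
            h.toFun (⟨U, s⟩ : SkewDuality.DualAlgebra F) =
              (⟨SkewDuality.CompactOpenDownset.comap φ.base U,
                φ.nat.app (op U.toOpens) s⟩ : SkewDuality.DualAlgebra E)) ∧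
      -- `λ` is determined by its components at compact open downsets
      (∀ (f : E.base ⟶ F.base) (l m : F.presheaf ⟶ SkewDuality.directImage f E.presheaf),
        (∀ U : SkewDuality.CompactOpenDownset F.base,
          l.app (op U.toOpens) = m.app (op U.toOpens)) → l = m) ∧
      -- `λ` is determined by its components on any basis of the topology
      (∀ (f : E.base ⟶ F.base) (l m : F.presheaf ⟶ SkewDuality.directImage f E.presheaf)
        (B : Set (Opens F.base)), Opens.IsBasis B →
        (∀ U ∈ B, l.app (op U) = m.app (op U)) → l = m) := by
  refine ⟨⟨fun h => ?_⟩, ⟨fun h => ?_⟩, fun E F => ⟨⟨fun φ ψ h => SkewDuality.map_injective h,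
    fun h => SkewDuality.exists_map_eq h⟩, fun h => ?_, fun f l m =>
    SkewDuality.DualAlgebra.nat_ext_compactOpenDownset, fun f l m B =>
    SkewDuality.DualAlgebra.nat_ext_basis⟩⟩
  · obtain ⟨φ, hφ⟩ := SkewDuality.exists_map_eq h
    exact ⟨φ.op, hφ⟩
  · exact Quiver.Hom.unop_inj (SkewDuality.map_injective h)
  · obtain ⟨φ, rfl⟩ := SkewDuality.exists_map_eq h
    refine ⟨φ, rfl, fun ψ hψ => SkewDuality.map_injective hψ, fun f => ⟨fun hf =>
      hf.unique (SkewDuality.barEqComap_map φ), ?_⟩, fun U s => rfl⟩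
    rintro rfl
    exact SkewDuality.barEqComap_map φ
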